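/- Let $\lambda$ be a regular cardinal and let $\mathcal V$ be a complete and cocomplete symmetric monoidal closed category in which $\lambda$-small conical limits commute with $\lambda$-directed colimits. Let $\mathcal K$ be a cocomplete $\mathcal V$-category with underlying category $\mathcal K_0$, and let $(\mathcal E,\mathcal M)$ be a $\lambda$-convenient $\mathcal V$-factorization system in $\mathcal K$. Then the following are equivalent: (i) $\mathcal K$ is $\mathcal M$-locally $\lambda$-generated, i.e. there is a set $\mathcal A$ of objects that are $\lambda$-generated w.r.t. $\mathcal M$ such that every object of $\mathcal K$ is a $\lambda$-directed colimit of objects from $\mathcal A$ and morphisms from $\mathcal M$; (ii) $\mathcal K_0$ has a strong generator formed by a set of objects that are $\lambda$-generated w.r.t. $\mathcal M$. Here $\lambda$-directed colimits in $\mathcal K$ (indexed by small $\lambda$-directed posets) are conical, and the following definitions are used. - An object $A$ is $\lambda$-generated w.r.t. $\mathcal M$ if $\mathcal K(A,-):\mathcal K\to\mathcal V$ preserves $\lambda$-directed colimits of diagrams all of whose morphisms lie in $\mathcal M$. - A morphism $e:A\to B$ is $\mathcal V$-orthogonal to $m:X\to Y$ if the square formed by $\mathcal K(B,m)$, $\mathcal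 K(A,m)$, $\mathcal K(e,X)$, $\mathcal K(e,Y)$ is a pullback in $\mathcal V$. A $\mathcal V$-factorization system consists of classes $\mathcal E,\mathcal M$ of morphisms of $\mathcal K_0$ such that $\mathcal E$ is the class of all morphisms $\mathcal V$-orthogonal to every $m\in\mathcal M$, $\mathcal M$ is the class of all morphisms to which every $e\in\mathcal E$ is $\mathcal V$-orthogonal, and every morphism factors as an $\mathcal E$-morphism followed by an $\mathcal M$-morphism. - It is $\lambda$-convenient if (1) every object has, up to isomorphism, only a set of $\mathcal E$-quotients (morphisms of $\mathcal E$ starting in it), and (2) for every $\lambda$-directed diagram of $\mathcal M$-morphisms in $\mathcal K_0$, the colimit cocone consists of $\mathcal M$-morphisms, and for every cocone of $\mathcal M$-morphisms on the diagram the induced morphism from the colimit is in $\mathcal M$. - A strong generator of $\mathcal K_0$ is a set $\mathcal G$ of objects such that any two distinct parallel morphisms $K\rightrightarrows L$ are distinguished by some morphism $G\to K$ with $G\in\mathcal G$, and for every proper subobject of an object $K$ there is a morphism $G\to K$ with $G\in\mathcal G$ that does not factor through it. -/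

import Mathlib

open CategoryTheory CategoryTheory.Limits CategoryTheory.MonoidalCategory

universe v u₁ u₂

namespace EnrichedLocGen

section Enriched

variable (V : Type u₁) [Category.{v} V] [MonoidalCategory V]
variable {K : Type u₂} [Category.{v} K] [EnrichedOrdinaryCategory V K]

/-- A cocone over an ordinary diagram `D : J ⥤ K` in (the underlying category of) a `V`-category
`K` is a conical colimit if it is a colimit cocone and, for every object `B`, the contravariant
hom-functor `K(-, B)` with values in `V` sends it to a limit cone. -/
def IsConicalColimit {J : Type v} [SmallCategory J] {D : J ⥤ K} (c : Cocone D) : Prop :=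
  Nonempty (IsColimit c) ∧
    ∀ B : K, Nonempty (IsLimit (((eHomFunctor V K).flip.obj B).mapCone c.op))

/-- A morphism `η : X ⟶ K(A, T)` exhibits `T` as the tensor of `A : K` by `X : V` if, for every
object `B`, the induced morphism `K(T, B) ⟶ [X, K(A, B)]` is an isomorphism in `V`. -/
def IsTensor [MonoidalClosed V] {X : V} {A T : K} (η : X ⟶ (A ⟶[V] T)) : Prop :=
  ∀ B : K, IsIso (MonoidalClosed.curry (η ▷ (T ⟶[V] B) ≫ eComp V A T B))

variable (K) in
/-- A `V`-category is cocomplete if it is tensored and has all small conical colimits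
(equivalently, if it has all small weighted colimits). -/
structure IsCocomplete [MonoidalClosed V] : Prop where
  exists_tensor : ∀ (X : V) (A : K), ∃ (T : K) (η : X ⟶ (A ⟶[V] T)), IsTensor V η
  exists_conicalColimit : ∀ (J : Type v) [SmallCategory J] (D : J ⥤ K),
    ∃ c : Cocone D, IsConicalColimit V c

/-- `e : A ⟶ B` is `V`-orthogonal to `m : X ⟶ Y` if the square with sides
`K(B, X) ⟶ K(B, Y) ⟶ K(A, Y)` and `K(B, X) ⟶ K(A, X) ⟶ K(A, Y)` is a pullback in `V`. -/
def IsEnrichedOrthogonal {A B X Y : K} (e : A ⟶ B) (m : X ⟶ Y) : Prop :=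
  IsPullback (eHomWhiskerLeft V B m) (eHomWhiskerRight V e X)
    (eHomWhiskerRight V e Y) (eHomWhiskerLeft V A m)

/-- `(E, M)` is a `V`-factorization system: each of the two classes consists of all morphisms that
are `V`-orthogonal to the other one, and every morphism factors as a morphism in `E` followed by a
morphism in `M`. -/
structure IsEnrichedFactorizationSystem (E M : MorphismProperty K) : Prop where
  left_iff : ∀ {A B : K} (e : A ⟶ B),
    E e ↔ ∀ {X Y : K} (m : X ⟶ Y), M m → IsEnrichedOrthogonal V e m
  right_iff : ∀ {X Y : K} (m : X ⟶ Y),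
    M m ↔ ∀ {A B : K} (e : A ⟶ B), E e → IsEnrichedOrthogonal V e m
  exists_factorization : ∀ {A B : K} (f : A ⟶ B),
    ∃ (Z : K) (e : A ⟶ Z) (m : Z ⟶ B), E e ∧ M m ∧ e ≫ m = f

/- In the following definitions, a `κ`-directed poset is a partially ordered (small) set `I`
with `IsCardinalFiltered I κ`, i.e. in which every family of fewer than `κ` elements
has an upper bound. -/

/-- The object `A` is `κ`-generated with respect to `M` if `K(A, -) : K ⥤ V` preserves
(conical) `κ`-directed colimits of diagrams whose morphisms lie in `M`. -/
def IsGeneratedWrt (κ : Cardinal.{v}) [Fact κ.IsRegular] (M : MorphismProperty K) (A : K) :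
    Prop :=
  ∀ (I : Type v) [PartialOrder I] [IsCardinalFiltered I κ] (D : I ⥤ K),
    (∀ {i j : I} (f : i ⟶ j), M (D.map f)) →
    ∀ c : Cocone D, IsConicalColimit V c → Nonempty (IsColimit ((eCoyoneda V A).mapCocone c))

/-- There is a (small) set `P` of objects that are `κ`-generated with respect to `M` such that every
object is a (conical) `κ`-directed colimit of objects from `P` and morphisms from `M`. -/
def IsLocallyGenerated (κ : Cardinal.{v}) [Fact κ.IsRegular] (M : MorphismProperty K) : Prop :=
  ∃ P : ObjectProperty K, ObjectProperty.Small.{v} P ∧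
    (∀ A : K, P A → IsGeneratedWrt V κ M A) ∧
    ∀ X : K, ∃ (I : Type v) (_ : PartialOrder I) (_ : IsCardinalFiltered I κ) (D : I ⥤ K)
      (c : Cocone D), (∀ i : I, P (D.obj i)) ∧ (∀ {i j : I} (f : i ⟶ j), M (D.map f)) ∧
        c.pt = X ∧ IsConicalColimit V c

end Enriched

/-- The pair `(E, M)` in an ordinary category is `κ`-convenient. -/
structure IsConvenient {K : Type u₂} [Category.{v} K] (κ : Cardinal.{v}) [Fact κ.IsRegular]
    (E M : MorphismProperty K) : Prop where
  /-- Every object has only a (small) set of `E`-quotients, up to isomorphism. -/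
  cowellpowered : ∀ A : K, ∃ (ι : Type v) (Q : ι → K) (q : ∀ i, A ⟶ Q i), (∀ i, E (q i)) ∧
    ∀ {B : K} (e : A ⟶ B), E e → ∃ (i : ι) (φ : Q i ≅ B), q i ≫ φ.hom = e
  /-- The colimit cocone of a `κ`-directed colimit of `M`-morphisms consists of `M`-morphisms. -/
  colimit_ι_mem : ∀ (I : Type v) [PartialOrder I] [IsCardinalFiltered I κ] (D : I ⥤ K),
    (∀ {i j : I} (f : i ⟶ j), M (D.map f)) →
    ∀ c : Cocone D, IsColimit c → ∀ i : I, M (c.ι.app i)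
  /-- For every cocone of `M`-morphisms on such a diagram, the factorizing morphism is in `M`. -/
  colimit_desc_mem : ∀ (I : Type v) [PartialOrder I] [IsCardinalFiltered I κ] (D : I ⥤ K),
    (∀ {i j : I} (f : i ⟶ j), M (D.map f)) →
    ∀ (c : Cocone D) (hc : IsColimit c) (s : Cocone D), (∀ i : I, M (s.ι.app i)) → M (hc.desc s)

/-- In the complete and cocomplete category `V`, limits of shape `J` commute with `κ`-directed
colimits, for every `κ`-small category `J` (i.e. with fewer than `κ` morphisms). -/
def SmallLimitsCommuteWithDirectedColimits (V : Type u₁) [Category.{v} V] [HasColimits V]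
    (κ : Cardinal.{v}) [Fact κ.IsRegular] : Prop :=
  ∀ (J : Type v) [SmallCategory J], HasCardinalLT (Arrow J) κ →
    ∀ (I : Type v) [PartialOrder I] [IsCardinalFiltered I κ],
      PreservesLimitsOfShape J (colim : (I ⥤ V) ⥤ V)

end EnrichedLocGen

/-! A class whose directed colimits give every object is a strong generator. Conversely, enlarge a
generator `G` to a small class `P` of generated objects closed under `κ`-small colimits and
`E`-quotients: both operations preserve generatedness because `κ`-small limits, in particular
pullbacks, commute with `κ`-directed colimits in `V` (`isGeneratedWrt_of_isColimit`,
`isGeneratedWrt_of_left`). The `M`-morphisms from `P` to `X` then form a `κ`-filtered diagram, and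
it remains to show that the comparison `m` from its colimit to `X` is invertible. Every map from `G`
to `X` lifts along `m`, so strong generation reduces this to `m` being monic. A map into the colimit
need not factor through a stage, since only the `V`-valued hom preserves it. So `K(A, m)` is shown
to be monic in `V` for `A` in `G`, by computing kernel pairs stagewise. Tensors turn generalized
elements of `K(A, D i)` into morphisms of `K`, which `G` separates, and coequalizers in `P` do the
rest. -/

namespace EnrichedLocGen

/-! ### Comparison morphisms and small limits -/

section Comparison

lemma isIso_app_pt_of_isLimit {J C D : Type*} [Category* J] [Category* C] [Category* D]
    {Φ Ψ : C ⥤ D} (φ : Φ ⟶ Ψ) {F : J ⥤ C} (c : Cone F) (hΦ : IsLimit (Φ.mapCone c))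
    (hΨ : IsLimit (Ψ.mapCone c)) (h : ∀ j, IsIso (φ.app (F.obj j))) : IsIso (φ.app c.pt) := by
  have : ∀ j, IsIso ((Functor.whiskerLeft F φ).app j) := h
  have : IsIso (Functor.whiskerLeft F φ) := NatIso.isIso_of_isIso_app _
  have e : φ.app c.pt =
      (IsLimit.conePointsIsoOfNatIso hΦ hΨ (asIso (Functor.whiskerLeft F φ))).hom := by
    refine hΨ.hom_ext fun j ↦ ?_
    rw [IsLimit.conePointsIsoOfNatIso_hom_comp]
    simp
  rw [e]
  infer_instance

lemma nonempty_isColimit_iff_isIso_desc {J C : Type*} [Category* J] [Category* C]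
    {F : J ⥤ C} [HasColimit F] (c : Cocone F) :
    Nonempty (IsColimit c) ↔ IsIso (colimit.desc F c) :=
  (colimit.isColimit F).nonempty_isColimit_iff_isIso_desc

/-- `WalkingCospan` is finite, hence `κ`-small; an equivalent category moves it into the universe of
the hypothesis. -/
lemma preservesLimitsOfShape_colim_walkingCospan {V : Type u₁} [Category.{v} V] [HasColimits V]
    {κ : Cardinal.{v}} [Fact κ.IsRegular] (hV : SmallLimitsCommuteWithDirectedColimits V κ)
    (I : Type v) [PartialOrder I] [IsCardinalFiltered I κ] :
    PreservesLimitsOfShape WalkingCospan (colim : (I ⥤ V) ⥤ V) := by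
  have hfin : HasCardinalLT (Arrow WalkingCospan) κ :=
    HasCardinalLT.of_le (by
      simp only [hasCardinalLT_aleph0_iff]
      infer_instance) (Cardinal.IsRegular.aleph0_le Fact.out)
  obtain ⟨S, ⟨e⟩⟩ := SmallCategoryCardinalLT.exists_equivalence κ WalkingCospan hfin
  have := hV _ S.hasCardinalLT I
  exact preservesLimitsOfShape_of_equiv e _

end Comparison

section Enriched

variable {V : Type u₁} [Category.{v} V] [MonoidalCategory V]
variable {K : Type u₂} [Category.{v} K] [EnrichedOrdinaryCategory V K]

/-! ### Conical colimits and tensors -/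

section Cocomplete

variable [MonoidalClosed V]

lemma IsCocomplete.hasColimits (hK : IsCocomplete V K) : HasColimits K where
  has_colimits_of_shape J _ :=
    { has_colimit D := by
        obtain ⟨c, ⟨hc⟩, -⟩ := hK.exists_conicalColimit J D
        exact ⟨⟨c, hc⟩⟩ }

/-- Some colimit of `D` is conical, and all colimits of `D` are isomorphic. -/
lemma IsCocomplete.isConicalColimit (hK : IsCocomplete V K) {J : Type v} [SmallCategory J]
    {D : J ⥤ K} {c : Cocone D} (hc : IsColimit c) : IsConicalColimit V c := by
  refine ⟨⟨hc⟩, fun B ↦ ?_⟩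
  obtain ⟨c', ⟨hc'⟩, h⟩ := hK.exists_conicalColimit J D
  obtain ⟨l⟩ := h B
  refine ⟨l.ofIsoLimit (Cone.ext (((eHomFunctor V K).flip.obj B).mapIso
    (hc.coconePointUniqueUpToIso hc').op) fun j ↦ ?_)⟩
  have := hc.comp_coconePointUniqueUpToIso_hom hc' j.unop
  exact (congrArg (eHomWhiskerRight V · B) this.symm).trans (eHomWhiskerRight_comp _ _ _ _)

variable (V) in
-- Describes the enriched tensor isomorphism on underlying morphisms; it yields the ordinary
-- universal property of `T`.
lemma curry_comp_eHomWhiskerLeft {X : V} {A T B : K} (η : X ⟶ (A ⟶[V] T)) (f : T ⟶ B) :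
    eHomEquiv V f ≫ MonoidalClosed.curry (η ▷ (T ⟶[V] B) ≫ eComp V A T B) =
      MonoidalClosed.curry ((ρ_ X).hom ≫ η ≫ eHomWhiskerLeft V A f) := by
  rw [← MonoidalClosed.curry_natural_left]
  congr 1
  rw [whisker_exchange_assoc]
  simp [eHomWhiskerLeft]

lemma IsTensor.hom_ext {X : V} {A T B : K} {η : X ⟶ (A ⟶[V] T)} (hη : IsTensor V η)
    {f g : T ⟶ B} (h : η ≫ eHomWhiskerLeft V A f = η ≫ eHomWhiskerLeft V A g) : f = g := by
  have := hη B
  apply (eHomEquiv V).injective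
  rw [← cancel_mono (MonoidalClosed.curry (η ▷ (T ⟶[V] B) ≫ eComp V A T B)),
    curry_comp_eHomWhiskerLeft, curry_comp_eHomWhiskerLeft, h]

lemma IsTensor.exists_desc {X : V} {A T B : K} {η : X ⟶ (A ⟶[V] T)} (hη : IsTensor V η)
    (w : X ⟶ (A ⟶[V] B)) : ∃ f : T ⟶ B, η ≫ eHomWhiskerLeft V A f = w := by
  have := hη B
  refine ⟨(eHomEquiv V).symm (MonoidalClosed.curry ((ρ_ X).hom ≫ w) ≫
    inv (MonoidalClosed.curry (η ▷ (T ⟶[V] B) ≫ eComp V A T B))), ?_⟩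
  rw [← cancel_epi (ρ_ X).hom]
  apply MonoidalClosed.curry_injective
  rw [← curry_comp_eHomWhiskerLeft]
  simp

end Cocomplete

variable (V) in
lemma eHomEquiv_comp_eHomWhiskerLeft {A B C : K} (f : A ⟶ B) (g : B ⟶ C) :
    eHomEquiv V f ≫ eHomWhiskerLeft V A g = eHomEquiv V (f ≫ g) := by
  rw [eHomEquiv_comp, eHomWhiskerLeft, rightUnitor_inv_naturality_assoc, MonoidalCategory.tensorHom_def_assoc,
    ← unitors_inv_equal]

/-! ### Generated objects under small colimits -/

section Generated

variable (V) in
/-- The comparison from the colimit of the objects `K(B, D i)` to `K(B, c.pt)`, as a natural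
transformation in `B`. -/
noncomputable def homComparison [HasColimits V] {I : Type v} [SmallCategory I] {D : I ⥤ K}
    (c : Cocone D) :
    eHomFunctor V K ⋙ (Functor.whiskeringLeft I K V).obj D ⋙ colim ⟶
      (eHomFunctor V K).flip.obj c.pt where
  app B := colimit.desc (D ⋙ (eHomFunctor V K).obj B) (((eHomFunctor V K).obj B).mapCocone c)
  naturality B B' f := by
    refine colimit.hom_ext fun i ↦ ?_
    dsimp
    simp only [ι_colimMap_assoc, colimit.ι_desc, Functor.mapCocone_ι_app,
      Functor.whiskerLeft_app, eHomFunctor_map_app, eHomFunctor_obj_map]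
    exact (eHom_whisker_exchange V f.unop (c.ι.app i)).symm.trans
      (colimit.ι_desc_assoc (((eHomFunctor V K).obj B).mapCocone c) i _).symm

variable [HasColimits V] {κ : Cardinal.{v}} [Fact κ.IsRegular]

/-- `K(-, B)` turns the colimit into a `κ`-small limit, so both sides of `homComparison` send `a.op`
to a limit cone, and invertibility at each `A.obj j` passes to `a.pt`. -/
lemma isGeneratedWrt_of_isColimit [MonoidalClosed V]
    (hV : SmallLimitsCommuteWithDirectedColimits V κ) (hK : IsCocomplete V K)
    {M : MorphismProperty K} {J : Type v} [SmallCategory J] (hJ : HasCardinalLT (Arrow J) κ)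
    {A : J ⥤ K} {a : Cocone A} (ha : IsColimit a) (hA : ∀ j, IsGeneratedWrt V κ M (A.obj j)) :
    IsGeneratedWrt V κ M a.pt := by
  intro I _ _ D hD c hc
  rw [nonempty_isColimit_iff_isIso_desc]
  change IsIso ((homComparison V c).app a.op.pt)
  have hlim := (hK.isConicalColimit ha).2
  have hJop : HasCardinalLT (Arrow Jᵒᵖ) κ := by simpa using hJ
  have := hV Jᵒᵖ hJop I
  have hL : IsLimit ((eHomFunctor V K ⋙ (Functor.whiskeringLeft I K V).obj D).mapCone a.op) :=
    evaluationJointlyReflectsLimits _ fun i ↦ (hlim (D.obj i)).some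
  refine isIso_app_pt_of_isLimit _ a.op (isLimitOfPreserves colim hL) (hlim c.pt).some fun j ↦ ?_
  exact (nonempty_isColimit_iff_isIso_desc _).1 (hA j.unop I D hD c hc)

end Generated

end Enriched

/-! ### Colimits over connected shapes -/

section Comparison

lemma colimMap_ι_comp_desc_const {I C : Type*} [Category* I] [Category* C] [HasColimitsOfShape I C]
    {F : I ⥤ C} (c : Cocone F) :
    colim.map c.ι ≫ colimit.desc ((Functor.const I).obj c.pt)
      (Cocone.mk c.pt (𝟙 ((Functor.const I).obj c.pt))) = colimit.desc F c := by
  refine colimit.hom_ext fun i ↦ ?_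
  simp

instance isIso_desc_const {I C : Type*} [Category* I] [IsConnected I] [Category* C]
    [HasColimitsOfShape I C] (X : C) :
    IsIso (colimit.desc ((Functor.const I).obj X)
      (Cocone.mk X (𝟙 ((Functor.const I).obj X)))) :=
  (nonempty_isColimit_iff_isIso_desc _).1 ⟨isColimitConstCocone I X⟩

lemma isIso_colimMap_ι_iff {I C : Type*} [Category* I] [IsConnected I] [Category* C]
    [HasColimitsOfShape I C] {F : I ⥤ C} (c : Cocone F) :
    IsIso (colim.map c.ι) ↔ Nonempty (IsColimit c) := by
  rw [nonempty_isColimit_iff_isIso_desc, ← colimMap_ι_comp_desc_const, isIso_comp_right_iff]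

lemma isPullback_of_forall_app {I C : Type*} [Category* I] [Category* C] [HasPullbacks C]
    {P X Y Z : I ⥤ C}
    {fst : P ⟶ X} {snd : P ⟶ Y} {f : X ⟶ Z} {g : Y ⟶ Z}
    (h : ∀ i, IsPullback (fst.app i) (snd.app i) (f.app i) (g.app i)) :
    IsPullback fst snd f g := by
  have w : fst ≫ f = snd ≫ g := by
    ext i
    exact (h i).w
  refine ⟨⟨w⟩, ⟨evaluationJointlyReflectsLimits _ fun i ↦ ?_⟩⟩
  exact (isLimitMapConePullbackConeEquiv ((evaluation I C).obj i) w).symm (h i).isLimit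

end Comparison

section Enriched

variable {V : Type u₁} [Category.{v} V] [MonoidalCategory V]
variable {K : Type u₂} [Category.{v} K] [EnrichedOrdinaryCategory V K]

/-! ### Factorization systems and generated objects under quotients -/

section FactorizationSystem

variable {E M : MorphismProperty K}

lemma IsEnrichedFactorizationSystem.right_comp (h : IsEnrichedFactorizationSystem V E M)
    {X Y Z : K} {f : X ⟶ Y} {g : Y ⟶ Z} (hf : M f) (hg : M g) : M (f ≫ g) := by
  rw [h.right_iff]
  intro A B e he
  have := ((h.right_iff f).1 hf e he).paste_horiz ((h.right_iff g).1 hg e he)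
  simpa [IsEnrichedOrthogonal] using this

lemma IsEnrichedFactorizationSystem.right_of_comp (h : IsEnrichedFactorizationSystem V E M)
    {X Y Z : K} {f : X ⟶ Y} {g : Y ⟶ Z} (hg : M g) (hfg : M (f ≫ g)) : M f := by
  rw [h.right_iff]
  intro A B e he
  refine IsPullback.of_right ?_ (eHom_whisker_exchange V e f) ((h.right_iff g).1 hg e he)
  simpa [IsEnrichedOrthogonal] using (h.right_iff _).1 hfg e he

lemma IsEnrichedFactorizationSystem.right_of_isIso (h : IsEnrichedFactorizationSystem V E M)
    {X Y : K} (f : X ⟶ Y) [IsIso f] : M f := by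
  rw [h.right_iff]
  intro A B e _
  have (C : K) : IsIso (eHomWhiskerLeft V C f) :=
    inferInstanceAs (IsIso (((eHomFunctor V K).obj (Opposite.op C)).map f))
  exact IsPullback.of_horiz_isIso ⟨eHom_whisker_exchange V e f⟩

end FactorizationSystem

variable [HasColimits V] {κ : Cardinal.{v}} [Fact κ.IsRegular]

/-- The colimit legs lie in `M`, so orthogonality to `e` makes the cocone for `B` a pullback of the
cocone for `A`. Taking `colim` preserves this pullback, and isomorphisms are stable under base
change. -/
lemma isGeneratedWrt_of_left [HasLimits V] (hV : SmallLimitsCommuteWithDirectedColimits V κ)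
    {E M : MorphismProperty K} (hEM : IsEnrichedFactorizationSystem V E M)
    (hconv : IsConvenient κ E M) {A B : K} {e : A ⟶ B} (he : E e) (hA : IsGeneratedWrt V κ M A) :
    IsGeneratedWrt V κ M B := by
  intro I _ _ D hD c hc
  have := isFiltered_of_isCardinalFiltered I κ
  have := IsFiltered.isConnected I
  have := preservesLimitsOfShape_colim_walkingCospan hV I
  let a : Cocone (D ⋙ eCoyoneda V A) := (eCoyoneda V A).mapCocone c
  let b : Cocone (D ⋙ eCoyoneda V B) := (eCoyoneda V B).mapCocone c
  let k : b.pt ⟶ a.pt := eHomWhiskerRight V e c.pt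
  have hpb : IsPullback b.ι (Functor.whiskerLeft D ((eHomFunctor V K).map e.op))
      ((Functor.const I).map k) a.ι :=
    isPullback_of_forall_app fun i ↦
      (hEM.right_iff _).1 (hconv.colimit_ι_mem I D hD c hc.1.some i) e he
  have := (isIso_colimMap_ι_iff a).2 (hA I D hD c hc)
  exact (isIso_colimMap_ι_iff b).1 (hpb.map colim).isIso_fst_of_isIso

/-- `K(A, m)` is a monomorphism if `A` is generated and any two generalized elements of `K(A, D i)`
with the same image in `K(A, X)` have the same image in `K(A, c.pt)`. -/
lemma mono_eHomWhiskerLeft_of_isColimit [HasLimits V]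
    (hV : SmallLimitsCommuteWithDirectedColimits V κ)
    {I : Type v} [PartialOrder I] [IsCardinalFiltered I κ] {D : I ⥤ K} {c : Cocone D} {A X : K}
    (hA : Nonempty (IsColimit ((eCoyoneda V A).mapCocone c))) (m : c.pt ⟶ X)
    (h : ∀ (i : I) (W : V) (p q : W ⟶ (A ⟶[V] D.obj i)),
      p ≫ eHomWhiskerLeft V A (c.ι.app i ≫ m) = q ≫ eHomWhiskerLeft V A (c.ι.app i ≫ m) →
        p ≫ eHomWhiskerLeft V A (c.ι.app i) = q ≫ eHomWhiskerLeft V A (c.ι.app i)) :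
    Mono (eHomWhiskerLeft V A m) := by
  have := isFiltered_of_isCardinalFiltered I κ
  have := IsFiltered.isConnected I
  have := preservesLimitsOfShape_colim_walkingCospan hV I
  let c' : Cocone (D ⋙ eCoyoneda V A) := (eCoyoneda V A).mapCocone c
  let k : c'.pt ⟶ (A ⟶[V] X) := eHomWhiskerLeft V A m
  let n : D ⋙ eCoyoneda V A ⟶ (Functor.const I).obj (A ⟶[V] X) :=
    c'.ι ≫ (Functor.const I).map k
  have : IsIso (colimit.desc _ c') := (nonempty_isColimit_iff_isIso_desc c').1 hA
  -- `colim` carries the stagewise kernel pair of `n` to the kernel pair of `colim.map n`; its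
  -- projections agree by `h`.
  have hpb := (IsPullback.of_hasPullback n n).map colim
  have heq : colim.map (pullback.fst n n) = colim.map (pullback.snd n n) := by
    rw [← cancel_mono (colimit.desc _ c')]
    refine colimit.hom_ext fun i ↦ ?_
    have hi : (pullback.fst n n).app i ≫ n.app i = (pullback.snd n n).app i ≫ n.app i :=
      NatTrans.congr_app pullback.condition i
    have hn : n.app i = eHomWhiskerLeft V A (c.ι.app i ≫ m) :=
      (eHomWhiskerLeft_comp V A _ _).symm
    rw [hn] at hi
    have := h i _ _ _ hi
    change _ ≫ c'.ι.app i = _ ≫ c'.ι.app i at this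
    simpa using this
  have hmono : Mono (colim.map n) := by
    constructor
    intro T a b hab
    exact (hpb.lift_fst a b hab).symm.trans
      ((congrArg (hpb.lift a b hab ≫ ·) heq).trans (hpb.lift_snd a b hab))
  have e : colimit.desc _ c' ≫ k = colim.map n ≫ colimit.desc ((Functor.const I).obj (A ⟶[V] X))
      (Cocone.mk _ (𝟙 ((Functor.const I).obj (A ⟶[V] X)))) := by
    refine colimit.hom_ext fun i ↦ ?_
    simp [n]
  have : Mono (colimit.desc _ c' ≫ k) := by
    rw [e]
    infer_instance
  exact (mono_comp_iff_of_isIso (colimit.desc _ c') k).1 this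

end Enriched

/-! ### Small closure of a class of objects -/

section Closure

variable {K : Type u₂} [Category.{v} K] (κ : Cardinal.{v})
  (Q : K → ObjectProperty K)

/-- The objects of `P`, the chosen colimits of `κ`-small diagrams in `P`, and the objects of `Q A`
for `A` in `P`. -/
def closureStep (P : ObjectProperty K) : ObjectProperty K :=
  P ⊔ (⨆ S : SmallCategoryCardinalLT κ,
    P.strictColimitsOfShape (SmallCategoryCardinalLT.categoryFamily κ S)) ⊔
    ⨆ A : Subtype P, Q A.1

instance (P : ObjectProperty K) [ObjectProperty.Small.{v} P]
    [∀ A, ObjectProperty.Small.{v} (Q A)] :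
    ObjectProperty.Small.{v} (closureStep κ Q P) := by
  dsimp only [closureStep]
  infer_instance

/-- The transfinite iteration of `closureStep`. -/
noncomputable def closureIter (G : ObjectProperty K) (α : κ.ord.ToType) : ObjectProperty K :=
  closureStep κ Q (G ⊔ ⨆ β : Set.Iio α, closureIter G β.1)
termination_by α
decreasing_by exact β.2

lemma small_closureIter (G : ObjectProperty K) [ObjectProperty.Small.{v} G]
    [∀ A, ObjectProperty.Small.{v} (Q A)] (α : κ.ord.ToType) :
    ObjectProperty.Small.{v} (closureIter κ Q G α) := by
  induction α using WellFoundedLT.induction with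
  | ind α ih =>
    rw [closureIter]
    have (β : Set.Iio α) : ObjectProperty.Small.{v} (closureIter κ Q G β.1) := ih β.1 β.2
    infer_instance

/-- Any small property of objects is contained in a small property that is closed under chosen
`κ`-small colimits and under the small properties `Q A`, and which is contained in every such
property. -/
lemma exists_small_closure [HasColimits K] [Fact κ.IsRegular] (G : ObjectProperty K)
    [ObjectProperty.Small.{v} G] [∀ A, ObjectProperty.Small.{v} (Q A)] :
    ∃ P : ObjectProperty K, ObjectProperty.Small.{v} P ∧ G ≤ P ∧
      (∀ (J : Type v) [SmallCategory J], HasCardinalLT (Arrow J) κ → ∀ F : J ⥤ K,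
        (∀ j, P (F.obj j)) → ∃ c : Cocone F, Nonempty (IsColimit c) ∧ P c.pt) ∧
      (∀ A, P A → Q A ≤ P) ∧
      ∀ R : ObjectProperty K, G ≤ R →
        (∀ (J : Type v) [SmallCategory J], HasCardinalLT (Arrow J) κ → ∀ (F : J ⥤ K),
          (∀ j, R (F.obj j)) → R (colimit F)) →
        (∀ A, R A → Q A ≤ R) → P ≤ R := by
  have := Cardinal.noMaxOrder (Cardinal.IsRegular.aleph0_le (Fact.out : κ.IsRegular))
  have hlt {α β : κ.ord.ToType} (h : α < β) :
      closureIter κ Q G α ≤ G ⊔ ⨆ γ : Set.Iio β, closureIter κ Q G γ.1 :=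
    le_sup_of_le_right (le_iSup (fun γ : Set.Iio β ↦ closureIter κ Q G γ.1) ⟨α, h⟩)
  have hstep (α : κ.ord.ToType) : closureStep κ Q (G ⊔ ⨆ γ : Set.Iio α, closureIter κ Q G γ.1) ≤
      ⨆ α, closureIter κ Q G α := by
    rw [← closureIter]
    exact le_iSup (closureIter κ Q G) α
  have hne : Nonempty κ.ord.ToType := IsCardinalFiltered.nonempty _ κ
  refine ⟨⨆ α, closureIter κ Q G α, ?_, ?_, ?_, ?_, ?_⟩
  · have := small_closureIter κ Q G
    infer_instance
  · exact le_trans (le_sup_left.trans (le_sup_left.trans le_sup_left)) (hstep hne.some)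
  · intro J _ hJ F hF
    obtain ⟨S, ⟨e⟩⟩ := SmallCategoryCardinalLT.exists_equivalence κ J hJ
    simp only [iSup_apply, iSup_Prop_eq] at hF
    choose α hα using hF
    -- By regularity of `κ`, fewer than `κ` stages have a bound; a strictly later `β` sees them all.
    let m := IsCardinalFiltered.max α (hasCardinalLT_of_hasCardinalLT_arrow hJ)
    obtain ⟨β, hβ⟩ := exists_gt m
    have hF' (j : J) : (G ⊔ ⨆ γ : Set.Iio β, closureIter κ Q G γ.1) (F.obj j) :=
      hlt ((leOfHom (IsCardinalFiltered.toMax α _ j)).trans_lt hβ) _ (hα j)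
    refine ⟨(Functor.Final.extendCocone (F := e.functor)).obj (colimit.cocone (e.functor ⋙ F)),
      ⟨(Functor.Final.isColimitExtendCoconeEquiv e.functor _).symm (colimit.isColimit _)⟩, ?_⟩
    · refine hstep β _ (Or.inl (Or.inr ?_))
      rw [iSup_apply, iSup_Prop_eq]
      exact ⟨S, .colimit (e.functor ⋙ F) fun j ↦ hF' _⟩
  · intro A hA B hB
    rw [iSup_apply, iSup_Prop_eq] at hA
    obtain ⟨α, hα⟩ := hA
    obtain ⟨β, hβ⟩ := exists_gt α
    refine hstep β _ (Or.inr ?_)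
    rw [iSup_apply, iSup_Prop_eq]
    exact ⟨⟨A, hlt hβ _ hα⟩, hB⟩
  · intro R hG hcol hQ
    refine iSup_le fun α ↦ ?_
    induction α using WellFoundedLT.induction with
    | ind α ih =>
      have hR : G ⊔ ⨆ γ : Set.Iio α, closureIter κ Q G γ.1 ≤ R :=
        sup_le hG (iSup_le fun γ ↦ ih γ.1 γ.2)
      rw [closureIter]
      refine sup_le (sup_le hR (iSup_le fun S ↦ ?_)) (iSup_le fun A ↦ hQ _ (hR _ A.2))
      rintro _ ⟨F, hF⟩
      exact hcol _ S.hasCardinalLT F fun j ↦ hR _ (hF j)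

end Closure

/-! ### The canonical diagram of `M`-morphisms -/

section Canonical

variable {K : Type u₂} [Category.{v} K]

/-- The objects of `Over X` given by a morphism in `M` whose source satisfies `P`. -/
def canonicalOver (P : ObjectProperty K) (M : MorphismProperty K) (X : K) :
    ObjectProperty (Over X) :=
  fun Y ↦ P Y.left ∧ M Y.hom

instance (P : ObjectProperty K) [ObjectProperty.Small.{v} P] (M : MorphismProperty K) (X : K) :
    ObjectProperty.Small.{v} (canonicalOver P M X) :=
  small_of_surjective
    (f := fun (y : Σ A : Subtype P, { f : A.1 ⟶ X // M f }) ↦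
      (⟨Over.mk y.2.1, y.1.2, y.2.2⟩ : Subtype (canonicalOver P M X)))
    (fun Y ↦ ⟨⟨⟨Y.1.left, Y.2.1⟩, ⟨Y.1.hom, Y.2.2⟩⟩, rfl⟩)

/-- The tautological cocone with point `X` over the canonical diagram of `X`. -/
abbrev canonicalCocone (P : ObjectProperty K) (M : MorphismProperty K) (X : K) :
    Cocone ((canonicalOver P M X).ι ⋙ Over.forget X) :=
  (Over.forgetCocone X).whisker (canonicalOver P M X).ι

lemma exists_coequalizing_factorization (κ : Cardinal.{v}) [Fact κ.IsRegular]
    {P : ObjectProperty K}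
    (hcol : ∀ (J : Type v) [SmallCategory J], HasCardinalLT (Arrow J) κ → ∀ F : J ⥤ K,
        (∀ j, P (F.obj j)) → ∃ c : Cocone F, Nonempty (IsColimit c) ∧ P c.pt)
    {A B X : K} (hA : P A) (hB : P B) {a b : A ⟶ B} {f : B ⟶ X} (hf : a ≫ f = b ≫ f) :
    ∃ (Q : K) (k : B ⟶ Q) (d : Q ⟶ X), P Q ∧ a ≫ k = b ≫ k ∧ k ≫ d = f := by
  have hfin : HasCardinalLT (Arrow WalkingParallelPair) κ :=
    HasCardinalLT.of_le (by
      simp only [hasCardinalLT_aleph0_iff]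
      infer_instance) (Cardinal.IsRegular.aleph0_le Fact.out)
  obtain ⟨S, ⟨e⟩⟩ := SmallCategoryCardinalLT.exists_equivalence κ WalkingParallelPair hfin
  obtain ⟨c, ⟨hc⟩, hcP⟩ := hcol _ S.hasCardinalLT (e.functor ⋙ parallelPair a b) fun j ↦ by
    change P ((parallelPair a b).obj (e.functor.obj j))
    rcases e.functor.obj j with _ | _
    exacts [hA, hB]
  let k : Cofork a b := (Functor.Final.extendCocone (F := e.functor)).obj c
  have hk : IsColimit k := (Functor.Final.isColimitExtendCoconeEquiv e.functor c).symm hc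
  exact ⟨k.pt, k.π, Cofork.IsColimit.desc hk f hf, hcP, k.condition,
    Cofork.IsColimit.π_desc' hk f hf⟩

/-- The colimit of a `κ`-small subdiagram lies in `P`; factoring its map to `X` through `M` gives
the vertex of a cocone. -/
lemma isCardinalFiltered_canonicalOver (κ : Cardinal.{v}) [Fact κ.IsRegular]
    {P : ObjectProperty K} {M : MorphismProperty K}
    (hcol : ∀ (J : Type v) [SmallCategory J], HasCardinalLT (Arrow J) κ → ∀ F : J ⥤ K,
        (∀ j, P (F.obj j)) → ∃ c : Cocone F, Nonempty (IsColimit c) ∧ P c.pt)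
    (hfac : ∀ {A X : K} (f : A ⟶ X), P A →
      ∃ (B : K) (e : A ⟶ B) (m : B ⟶ X), P B ∧ M m ∧ e ≫ m = f) (X : K) :
    IsCardinalFiltered (canonicalOver P M X).FullSubcategory κ where
  nonempty_cocone {J _} F hJ := by
    let U := (canonicalOver P M X).ι ⋙ Over.forget X
    obtain ⟨c, ⟨hc⟩, hcP⟩ := hcol J hJ (F ⋙ U) fun j ↦ (F.obj j).2.1
    let s : Cocone (F ⋙ U) := (canonicalCocone P M X).whisker F
    obtain ⟨B, e, m, hB, hm, fac⟩ := hfac (hc.desc s) hcP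
    exact ⟨{
      pt := ⟨Over.mk m, hB, hm⟩
      ι :=
        { app j := ObjectProperty.homMk (Over.homMk (c.ι.app j ≫ e) (by
            change (c.ι.app j ≫ e) ≫ m = s.ι.app j
            rw [Category.assoc, fac, hc.fac]))
          naturality j j' f := by
            ext
            have := c.w f
            simpa using! congrArg (· ≫ e) this } }⟩

end Canonical

/-! ### The two implications -/

section Enriched

variable {V : Type u₁} [Category.{v} V] [MonoidalCategory V]
variable {K : Type u₂} [Category.{v} K] [EnrichedOrdinaryCategory V K]

lemma isStrongGenerator_of_directed_colimits {κ : Cardinal.{v}} [Fact κ.IsRegular]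
    {P : ObjectProperty K}
    (h : ∀ X : K, ∃ (I : Type v) (_ : PartialOrder I) (_ : IsCardinalFiltered I κ) (D : I ⥤ K)
      (c : Cocone D), (∀ i : I, P (D.obj i)) ∧ c.pt = X ∧ IsConicalColimit V c) :
    P.IsStrongGenerator := by
  refine ObjectProperty.IsStrongGenerator.mk_of_exists_colimitsOfShape.{v} fun X ↦ ?_
  obtain ⟨I, _, _, D, c, hD, rfl, ⟨⟨hc⟩, -⟩⟩ := h X
  exact ⟨I, inferInstance, ⟨{ diag := D, ι := c.ι, isColimit := hc, prop_diag_obj := hD }⟩⟩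

variable [MonoidalClosed V] [HasLimits V] [HasColimits V] {κ : Cardinal.{v}} [Fact κ.IsRegular]
  {E M : MorphismProperty K}

/-- A small class of generated objects is contained in a small class of generated objects that is
closed under `κ`-small colimits and through which `(E, M)`-factorizations can be chosen. -/
lemma exists_small_generated_closure
    (hV : SmallLimitsCommuteWithDirectedColimits V κ) (hK : IsCocomplete V K)
    (hEM : IsEnrichedFactorizationSystem V E M) (hconv : IsConvenient κ E M)
    (G : ObjectProperty K) [ObjectProperty.Small.{v} G]
    (hG : ∀ A, G A → IsGeneratedWrt V κ M A) :
    ∃ P : ObjectProperty K, ObjectProperty.Small.{v} P ∧ G ≤ P ∧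
      (∀ A, P A → IsGeneratedWrt V κ M A) ∧
      (∀ (J : Type v) [SmallCategory J], HasCardinalLT (Arrow J) κ → ∀ F : J ⥤ K,
        (∀ j, P (F.obj j)) → ∃ c : Cocone F, Nonempty (IsColimit c) ∧ P c.pt) ∧
      ∀ {A X : K} (f : A ⟶ X), P A →
        ∃ (B : K) (e : A ⟶ B) (m : B ⟶ X), P B ∧ M m ∧ e ≫ m = f := by
  have := hK.hasColimits
  choose ι Q q hqE hq using hconv.cowellpowered
  obtain ⟨P, hP, hGP, hcol, hQ, hle⟩ :=
    exists_small_closure κ (fun A ↦ ObjectProperty.ofObj (Q A)) G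
  refine ⟨P, hP, hGP, ?_, hcol, ?_⟩
  · refine hle (IsGeneratedWrt V κ M) hG (fun J _ hJ F hF ↦ ?_) fun A hA ↦ ?_
    · exact isGeneratedWrt_of_isColimit hV hK hJ (colimit.isColimit F) hF
    · rintro _ ⟨i⟩
      exact isGeneratedWrt_of_left hV hEM hconv (hqE A i) hA
  · intro A X f hA
    obtain ⟨Z, e, m, he, hm, rfl⟩ := hEM.exists_factorization f
    obtain ⟨i, φ, rfl⟩ := hq A e he
    exact ⟨Q A i, q A i, φ.hom ≫ m, hQ A hA _ ⟨i⟩,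
      hEM.right_comp (hEM.right_of_isIso φ.hom) hm, by simp⟩

lemma exists_directed_colimit
    (hV : SmallLimitsCommuteWithDirectedColimits V κ) (hK : IsCocomplete V K)
    (hEM : IsEnrichedFactorizationSystem V E M)
    {G P : ObjectProperty K} (hG : G.IsStrongGenerator) [ObjectProperty.Small.{v} P] (hGP : G ≤ P)
    (hP : ∀ A, P A → IsGeneratedWrt V κ M A)
    (hcol : ∀ (J : Type v) [SmallCategory J], HasCardinalLT (Arrow J) κ → ∀ F : J ⥤ K,
        (∀ j, P (F.obj j)) → ∃ c : Cocone F, Nonempty (IsColimit c) ∧ P c.pt)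
    (hfac : ∀ {A X : K} (f : A ⟶ X), P A →
      ∃ (B : K) (e : A ⟶ B) (m : B ⟶ X), P B ∧ M m ∧ e ≫ m = f) (X : K) :
    ∃ (I : Type v) (_ : PartialOrder I) (_ : IsCardinalFiltered I κ) (D : I ⥤ K)
      (c : Cocone D), (∀ i : I, P (D.obj i)) ∧ (∀ {i j : I} (f : i ⟶ j), M (D.map f)) ∧
        c.pt = X ∧ IsConicalColimit V c := by
  have := hK.hasColimits
  have hfilt := isCardinalFiltered_canonicalOver κ hcol hfac X
  let C := (canonicalOver P M X).FullSubcategory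
  let U : C ⥤ K := (canonicalOver P M X).ι ⋙ Over.forget X
  have : EssentiallySmall.{v} C := inferInstance
  have := IsCardinalFiltered.of_equivalence κ (equivSmallModel.{v} C)
  obtain ⟨I, _, hI, F', _⟩ := IsCardinalFiltered.exists_cardinal_directed (SmallModel.{v} C) κ
  let F : I ⥤ C := F' ⋙ (equivSmallModel.{v} C).inverse
  have : F.Final := inferInstanceAs (F' ⋙ (equivSmallModel.{v} C).inverse).Final
  let D : I ⥤ K := F ⋙ U
  -- Left cancellation for `M`: both structure maps to `X` are in `M`.
  have hD {i j : I} (f : i ⟶ j) : M (D.map f) :=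
    hEM.right_of_comp (F.obj j).2.2 (by
      have : D.map f ≫ (F.obj j).1.hom = (F.obj i).1.hom := Over.w (F.map f).hom
      rw [this]
      exact (F.obj i).2.2)
  let c : Cocone D := colimit.cocone D
  have hc : IsColimit c := colimit.isColimit D
  let t : Cocone U := Functor.Final.extendCocone.obj c
  have ht (i : I) : t.ι.app (F.obj i) = c.ι.app i :=
    (Functor.Final.extendCocone_obj_ι_app' c (𝟙 (F.obj i))).trans
      ((congrArg (· ≫ c.ι.app i) (U.map_id (F.obj i))).trans (Category.id_comp _))
  let s : Cocone D := (canonicalCocone P M X).whisker F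
  let m : c.pt ⟶ X := hc.desc s
  have hm (i : I) : c.ι.app i ≫ m = s.ι.app i := hc.fac s i
  -- Finality extends the compatibility from the indices in `I` to all of `C`.
  have htm (Y : C) : t.ι.app Y ≫ m = (canonicalCocone P M X).ι.app Y := by
    let f := Functor.Final.homToLift F Y
    have h : U.map f ≫ t.ι.app _ ≫ m = U.map f ≫ s.ι.app _ :=
      U.map f ≫= ((congrArg (· ≫ m) (ht _)).trans (hm _))
    exact (congrArg (· ≫ m) (t.w f).symm).trans
      ((Category.assoc _ _ _).trans (h.trans ((canonicalCocone P M X).w f)))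
  -- The coequalizer of `a` and `b` lies in `P`; its `M`-image in `X` is a further object of the
  -- diagram, where the two maps already agree.
  have hcoeq (i : I) (A : K) (hA : G A) (a b : A ⟶ D.obj i)
      (hab : a ≫ s.ι.app i = b ≫ s.ι.app i) : a ≫ c.ι.app i = b ≫ c.ι.app i := by
    obtain ⟨Q, k, d, hQ, hk, hkd⟩ :=
      exists_coequalizing_factorization κ hcol (hGP A hA) (F.obj i).2.1 hab
    obtain ⟨B, e, n, hB, hn, rfl⟩ := hfac d hQ
    let Y : C := ⟨Over.mk n, hB, hn⟩
    let g : F.obj i ⟶ Y :=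
      ObjectProperty.homMk (Over.homMk (k ≫ e) ((Category.assoc _ _ _).trans hkd))
    have hg : k ≫ e ≫ t.ι.app Y = c.ι.app i :=
      (Category.assoc _ _ _).symm.trans ((t.w g).trans (ht i))
    rw [← hg]
    exact (Category.assoc _ _ _).symm.trans
      ((congrArg (· ≫ e ≫ t.ι.app Y) hk).trans (Category.assoc _ _ _))
  have hmonoG (A : K) (hA : G A) : Mono (eHomWhiskerLeft V A m) := by
    refine mono_eHomWhiskerLeft_of_isColimit hV
      (hP A (hGP A hA) I D hD c (hK.isConicalColimit hc)) m fun i W p q hpq ↦ ?_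
    -- The tensor `T` need not lie in `P`, so `hcoeq` is applied after restricting along maps from
    -- `G`.
    obtain ⟨T, η, hη⟩ := hK.exists_tensor W A
    obtain ⟨f, rfl⟩ := hη.exists_desc p
    obtain ⟨g, rfl⟩ := hη.exists_desc q
    simp only [Category.assoc, ← eHomWhiskerLeft_comp] at hpq ⊢
    have hfg := hη.hom_ext hpq
    rw [hm] at hfg
    congr 2
    refine hG.isSeparating _ _ fun B hB h ↦ ?_
    simpa using hcoeq i B hB (h ≫ f) (h ≫ g) 
      ((Category.assoc _ _ _).trans ((h ≫= hfg).trans (Category.assoc _ _ _).symm))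
  have hmono : Mono m := by
    constructor
    intro T a b hab
    refine hG.isSeparating _ _ fun B hB h ↦ ?_
    have := hmonoG B hB
    apply (eHomEquiv V).injective
    rw [← cancel_mono (eHomWhiskerLeft V B m), eHomEquiv_comp_eHomWhiskerLeft,
      eHomEquiv_comp_eHomWhiskerLeft, Category.assoc, Category.assoc, hab]
  have hiso : IsIso m := by
    refine hG.isIso_of_mono m fun A hA f ↦ ?_
    -- The `M`-part of `f` is itself an object of the canonical diagram, so `f` lifts along `m`.
    obtain ⟨B, e, n, hB, hn, rfl⟩ := hfac f (hGP A hA)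
    exact ⟨e ≫ t.ι.app ⟨Over.mk n, hB, hn⟩, (Category.assoc _ _ _).trans (e ≫= htm ⟨Over.mk n, hB, hn⟩)⟩
  have : IsIso (hc.desc s) := hiso
  exact ⟨I, inferInstance, hI, D, s, fun i ↦ (F.obj i).2.1, hD, rfl,
    hK.isConicalColimit (hc.ofPointIso (t := s))⟩

end Enriched

end EnrichedLocGen

theorem mainTheorem10
    (V : Type u₁) [Category.{v} V] [MonoidalCategory V] [SymmetricCategory V] [MonoidalClosed V]
    [HasLimits V] [HasColimits V]
    (κ : Cardinal.{v}) [Fact κ.IsRegular]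
    (hV : EnrichedLocGen.SmallLimitsCommuteWithDirectedColimits V κ)
    (K : Type u₂) [Category.{v} K] [EnrichedOrdinaryCategory V K]
    (hK : EnrichedLocGen.IsCocomplete V K)
    (E M : MorphismProperty K)
    (hEM : EnrichedLocGen.IsEnrichedFactorizationSystem V E M)
    (hconv : EnrichedLocGen.IsConvenient κ E M) :
    EnrichedLocGen.IsLocallyGenerated V κ M ↔
      ∃ G : ObjectProperty K, ObjectProperty.Small.{v} G ∧ G.IsStrongGenerator ∧
        ∀ A : K, G A → EnrichedLocGen.IsGeneratedWrt V κ M A := by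
  constructor
  · rintro ⟨P, hP, hgen, hX⟩
    refine ⟨P, hP, EnrichedLocGen.isStrongGenerator_of_directed_colimits (V := V) (κ := κ)
      fun X ↦ ?_, hgen⟩
    obtain ⟨I, _, _, D, c, hD, -, h⟩ := hX X
    exact ⟨I, inferInstance, inferInstance, D, c, hD, h⟩
  · rintro ⟨G, _, hG, hgen⟩
    obtain ⟨P, hP, hGP, hPgen, hcol, hfac⟩ :=
      EnrichedLocGen.exists_small_generated_closure hV hK hEM hconv G hgen
    exact ⟨P, hP, hPgen, fun X ↦
      EnrichedLocGen.exists_directed_colimit hV hK hEM hG hGP hPgen hcol hfac X⟩
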